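/- Let $s,t\ge 1$, $n:=2^s-1$, and let $\gamma$ be a primitive element of $\mathbb F_{2^s}$. Let $\boldsymbol x$ be a codeword of the primitive binary BCH code of length $n$, i.e. the cyclic binary code with zeroes $\gamma,\gamma^3,\dots,\gamma^{2t-1}$ and their conjugates, let $\boldsymbol e\in\mathbb F_2^n$ and $\boldsymbol y=\boldsymbol x+\boldsymbol e$. Put $S_j:=y(\gamma^j)$, where $y(X)=y_0+y_1X+\dots+y_{n-1}X^{n-1}$, and $S(X):=S_1+S_2X+\dots+S_{2t}X^{2t-1}$. Let $I:=\{\gamma^i : e_i\ne 0\}\subseteq \mathbb F_{2^s}^*$ be the set of erroneous coordinates, $\varepsilon:=|I|$, and $\sigma(X):=\prod_{\alpha\in I}(1+\alpha X)$. For a polynomial $f$ write $f(X)=f_{\rm even}(X^2)+Xf_{\rm odd}(X^2)$, and let $\mu:\mathbb F_{2^s}[X]^2\to\mathbb F_{2^s}[X]$ be the bijection $\mu(u,v):=v(X^2)+Xu(X^2)$, with inverse $f\mapsto(f_{\rm odd},f_{\rm even})$. Let $$N:=\Big\{(u,v)\in\mathbb F_{2^s}[X]^2 : u\equiv \frac{S_{\rm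 even}(X)}{1+XS_{\rm odd}(X)}\,v \bmod X^t\Big\}.$$ Let $<_{-1}$ be the monomial ordering on $\mathbb F_{2^s}[X]^2$ in which $(X^i,0)<_{-1}(X^j,0)$ iff $i<j$, $(0,X^i)<_{-1}(0,X^j)$ iff $i<j$, and $(X^i,0)<_{-1}(0,X^j)$ iff $i\le j-1$. Let $\{\boldsymbol h_1=(h_{10},h_{11}),\boldsymbol h_2=(h_{20},h_{21})\}$ be a Gröbner basis of $N$ with respect to $<_{-1}$ such that the leading monomial of $\boldsymbol h_1$ is of the form $(X^i,0)$ and that of $\boldsymbol h_2$ is of the form $(0,X^j)$. Put $\hat h_i:=\mu(\boldsymbol h_i)$, and let $f_1,f_2\in\mathbb F_{2^s}[X]$ be the (unique) polynomials with $\mu^{-1}(\sigma)=f_1\boldsymbol h_1+f_2\boldsymbol h_2$. Let $J\subseteq\mathbb F_{2^s}^*$, let $m,\rho\ge 1$ be integers, and for $x\in\mathbb F_{2^s}^*$ put $m_x:=m$ if $x\in J$ and $m_x:=0$ otherwise. Let $M(\boldsymbol m,\rho)$ be the set of all polynomials $R=\sum_{j=0}^{\rho}\sum_i a_{ij}X^iY^jZ^{\rho-j}\in\mathbb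 F_{2^s}[X,Y,Z]$ whose multiplicity at the point $(x^2,\hat h_2(x),\hat h_1(x))$ is at least $m_{x^{-1}}$ for every $x\in\mathbb F_{2^s}^*$ (the multiplicity at a point is the least total order of a Hasse derivative that does not vanish there, and $\infty$ for the zero polynomial), and let $\widetilde M(\boldsymbol m,\rho):=\{R(X,Y,1) : R\in M(\boldsymbol m,\rho)\}\subseteq\mathbb F_{2^s}[X,Y]$. Put $w:=2\deg(h_{21})-t-\tfrac12$; the $(1,w)$-weighted degree of a non-zero polynomial in $X,Y$ is the maximum of $i+wj$ over all monomials $X^iY^j$ appearing in it. If $$m\cdot|I\cap J|>\begin{cases}\dfrac{|J|\,m(m+1)}{2(\rho+1)}+\dfrac{\rho}{2}\Big(\varepsilon-t-\dfrac12\Big) & \text{if }\rho\text{ is odd},\\[2ex] \dfrac{|J|\,m(m+1)+1}{2(\rho+1)}+\dfrac{\rho}{2}\Big(\varepsilon-t-\dfrac12\Big) & \text{if }\rho\text{ is even},\end{cases}$$ and if $f_2\neq 0$, then every non-zero polynomial $Q(X,Y)$ of minimal $(1,w)$-weighted degree in $\widetilde M(\boldsymbol m,\rho)\smallsetminus\{0\}$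 is divisible by $Yf_2(X)+f_1(X)$ in $\mathbb F_{2^s}[X,Y]$. -/

import Mathlib

open Polynomial

namespace BinaryBCH

/-! ### Weighted degrees, Hasse derivatives and multiplicities -/

section MultivariatePolynomials

variable {K : Type*} [Field K]

/-- The `w`-weighted degree of a polynomial, with value `⊥` (i.e. `-∞`) at `0`. -/
noncomputable def wdeg {n : ℕ} (w : Fin n → ℚ) (f : MvPolynomial (Fin n) K) : WithBot ℚ :=
  f.support.sup fun d => ((∑ i, w i * (d i : ℚ) : ℚ) : WithBot ℚ)

/-- The `d`-th Hasse derivative of `g`: the coefficient of `Y ^ d` in `g (X + Y)`,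
where `g (X + Y)` is viewed as a polynomial in `Y` over `K[X]`. -/
noncomputable def hasse {n : ℕ} (d : Fin n →₀ ℕ) (g : MvPolynomial (Fin n) K) :
    MvPolynomial (Fin n) K :=
  MvPolynomial.coeff d
    (MvPolynomial.aeval
      (fun i => (MvPolynomial.C (MvPolynomial.X i) + MvPolynomial.X i :
        MvPolynomial (Fin n) (MvPolynomial (Fin n) K))) g)

/-- The multiplicity of `g` at the point `a`: the least total weight of an index whose Hasse
derivative does not vanish at `a`, and `⊤` if there is none (i.e. if `g = 0`). -/
noncomputable def mult {n : ℕ} (g : MvPolynomial (Fin n) K) (a : Fin n → K) : ℕ∞ :=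
  ⨅ (d : Fin n →₀ ℕ) (_ : MvPolynomial.eval a (hasse d g) ≠ 0), (d.degree : ℕ∞)

/-- The polynomials in `K[X, Y, Z]` (variables numbered `0, 1, 2`) that are
`(Y, Z)`-homogeneous of `(Y, Z)`-homogeneous degree `ρ`. -/
def homog (K : Type*) [Field K] (ρ : ℕ) : Set (MvPolynomial (Fin 3) K) :=
  {Q | ∀ d ∈ Q.support, d 1 + d 2 = ρ}

/-- De-homogenization `f(X, Y, Z) ↦ f(X, Y, 1)`. -/
noncomputable def dehomog (f : MvPolynomial (Fin 3) K) : MvPolynomial (Fin 2) K :=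
  MvPolynomial.aeval ![MvPolynomial.X 0, MvPolynomial.X 1, 1] f

/-- A univariate polynomial `p(X)` regarded as an element of `K[X, Y]`. -/
noncomputable def inX (p : K[X]) : MvPolynomial (Fin 2) K :=
  Polynomial.aeval (MvPolynomial.X 0) p

end MultivariatePolynomials

/-! ### Monomial orderings and Gröbner bases on `K[X]²` -/

section Groebner

variable {K : Type*} [Field K]

/-- The monomial ordering `<_w` on `K[X]²`. The monomial `(X ^ j, 0)` is represented by
`Sum.inl j`, the monomial `(0, X ^ j)` by `Sum.inr j`. -/
def monLT (w : ℚ) : ℕ ⊕ ℕ → ℕ ⊕ ℕ → Prop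
  | Sum.inl i, Sum.inl j => i < j
  | Sum.inr i, Sum.inr j => i < j
  | Sum.inl i, Sum.inr j => (i : ℚ) ≤ (j : ℚ) + w
  | Sum.inr i, Sum.inl j => (i : ℚ) + w < (j : ℚ)

/-- The coefficient of a monomial in an element of `K[X]²`. -/
noncomputable def monCoeff (p : K[X] × K[X]) : ℕ ⊕ ℕ → K
  | Sum.inl j => p.1.coeff j
  | Sum.inr j => p.2.coeff j

/-- Divisibility of monomials in `K[X]²`: same unit vector, and division of the powers of `X`. -/
def monDvd : ℕ ⊕ ℕ → ℕ ⊕ ℕ → Prop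
  | Sum.inl i, Sum.inl j => i ≤ j
  | Sum.inr i, Sum.inr j => i ≤ j
  | _, _ => False

/-- `a` is the leading monomial of `p` with respect to `<_w`. -/
def IsLeadingMonomial (w : ℚ) (p : K[X] × K[X]) (a : ℕ ⊕ ℕ) : Prop :=
  monCoeff p a ≠ 0 ∧ ∀ b, monCoeff p b ≠ 0 → b ≠ a → monLT w b a

/-- `G` is a Gröbner basis of the submodule `N` of `K[X]²` with respect to `<_w`: it is a finite
subset of `N`, and the leading monomial of every non-zero element of `N` is divisible by the
leading monomial of some element of `G`. -/
def IsGroebnerBasis (w : ℚ) (N : Submodule K[X] (K[X] × K[X])) (G : Set (K[X] × K[X])) : Prop :=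
  G.Finite ∧ G ⊆ N ∧
    ∀ p ∈ N, p ≠ 0 → ∃ g ∈ G, ∃ a b,
      IsLeadingMonomial w g a ∧ IsLeadingMonomial w p b ∧ monDvd a b

end Groebner

/-! ### Odd and even parts, and the gluing map `μ` -/

section Parts

variable {K : Type*} [Field K]

/-- The even part `f₀ + f₂ X + f₄ X² + ⋯` of `f`. -/
noncomputable def evenPart (f : K[X]) : K[X] := contract 2 f

/-- The odd part `f₁ + f₃ X + f₅ X² + ⋯` of `f`. -/
noncomputable def oddPart (f : K[X]) : K[X] := contract 2 (divX f)

theorem coeff_evenPart (f : K[X]) (j : ℕ) : (evenPart f).coeff j = f.coeff (2 * j) := by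
  rw [evenPart, coeff_contract two_ne_zero, mul_comm]

theorem coeff_oddPart (f : K[X]) (j : ℕ) : (oddPart f).coeff j = f.coeff (2 * j + 1) := by
  rw [oddPart, coeff_contract two_ne_zero, coeff_divX, mul_comm]

/-- The bijection `μ(u, v) = v(X²) + X u(X²)`, with inverse `f ↦ (odd part, even part)`. -/
noncomputable def mu : (K[X] × K[X]) ≃+ K[X] where
  toFun p := expand K 2 p.2 + X * expand K 2 p.1
  invFun f := (oddPart f, evenPart f)
  left_inv p := by
    have h2 : ¬ (2 ∣ 1) := by norm_num
    ext j
    · simp only [coeff_oddPart, coeff_add, coeff_X_mul]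
      rw [coeff_expand two_pos, coeff_expand two_pos, if_neg (by omega), if_pos (by omega)]
      simp
    · simp only [coeff_evenPart, coeff_add]
      rw [coeff_expand two_pos, if_pos (by omega)]
      cases j with
      | zero => simp
      | succ j =>
        rw [show 2 * (j + 1) = (2 * j + 1) + 1 by ring, coeff_X_mul, coeff_expand two_pos,
          if_neg (by omega)]
        simp [show (2 * j + 1 + 1) / 2 = j + 1 by omega]
  right_inv f := by
    ext k
    simp only [coeff_add]
    obtain ⟨j, rfl | rfl⟩ := Nat.even_or_odd' k
    · rw [coeff_expand two_pos, if_pos (by omega)]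
      cases j with
      | zero => simp [coeff_evenPart]
      | succ j =>
        rw [show 2 * (j + 1) = (2 * j + 1) + 1 by ring, coeff_X_mul, coeff_expand two_pos,
          if_neg (by omega), coeff_evenPart]
        simp [show 2 * ((2 * j + 1 + 1) / 2) = 2 * j + 1 + 1 by omega]
    · rw [coeff_X_mul, coeff_expand two_pos, coeff_expand two_pos, if_neg (by omega),
        if_pos (by omega), coeff_oddPart]
      simp
  map_add' p q := by
    simp only [Prod.fst_add, Prod.snd_add, map_add]
    ring

end Parts

/-! ### Binary BCH codes, syndromes and the solution module -/

section Code

variable {K : Type*} [Field K] [Algebra (ZMod 2) K]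

/-- The polynomial `f₀ + f₁ X + ⋯ + f_{n-1} X ^ (n-1)` of a binary vector `f`. -/
noncomputable def vecPoly {n : ℕ} (f : Fin n → ZMod 2) : (ZMod 2)[X] :=
  ∑ i : Fin n, C (f i) * X ^ (i : ℕ)

/-- The cyclic binary code of length `n` with zeroes `γ, γ³, …, γ ^ (2t-1)` and their conjugates. -/
def bchCode (n t : ℕ) (γ : Kˣ) : Set (Fin n → ZMod 2) :=
  {c | ∀ i < t, ∀ k : ℕ, Polynomial.aeval (((γ : K) ^ (2 * i + 1)) ^ (2 ^ k)) (vecPoly c) = 0}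

/-- The syndrome polynomial `S₁ + S₂ X + ⋯ + S_{2t} X ^ (2t-1)` of the received word `y`, where
`S_j = y(γ ^ j)`. -/
noncomputable def syndromePoly {n : ℕ} (t : ℕ) (γ : Kˣ) (y : Fin n → ZMod 2) : K[X] :=
  ∑ j ∈ Finset.range (2 * t), C (Polynomial.aeval ((γ : K) ^ (j + 1)) (vecPoly y)) * X ^ j

/-- The set of erroneous coordinates of the error vector `e`; coordinate number `i` is labelled
by `γ ^ i`. -/
def errorSet [DecidableEq K] {n : ℕ} (γ : Kˣ) (e : Fin n → ZMod 2) : Finset Kˣ :=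
  (Finset.univ.filter fun i : Fin n => e i ≠ 0).image fun i : Fin n => γ ^ (i : ℕ)

end Code

section Solution

variable {K : Type*} [Field K]

/-- The error locator polynomial of a set of error locations. -/
noncomputable def elp (I : Finset Kˣ) : K[X] := ∏ α ∈ I, (1 + C (α : K) * X)

/-- The power series `S_even(X) / (1 + X S_odd(X))`. -/
noncomputable def modifiedSyndrome (S : K[X]) : PowerSeries K :=
  (evenPart S : PowerSeries K) * (1 + PowerSeries.X * (oddPart S : PowerSeries K))⁻¹

/-- The solution module of the modified key equation: all pairs `(u, v)` with
`u ≡ S_even / (1 + X S_odd) · v mod X ^ t`. -/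
noncomputable def solModule (t : ℕ) (S : K[X]) : Submodule K[X] (K[X] × K[X]) where
  carrier := {p | (PowerSeries.X : PowerSeries K) ^ t ∣
    (p.1 : PowerSeries K) - modifiedSyndrome S * (p.2 : PowerSeries K)}
  zero_mem' := by simp
  add_mem' {p q} hp hq := by
    have h := dvd_add hp hq
    simp only [Set.mem_ofPred_eq, Prod.fst_add, Prod.snd_add, Polynomial.coe_add]
    convert h using 1
    ring
  smul_mem' c p hp := by
    have h := Dvd.dvd.mul_left hp (c : PowerSeries K)
    simp only [Set.mem_ofPred_eq, Prod.smul_fst, Prod.smul_snd, smul_eq_mul, Polynomial.coe_mul]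
    convert h using 1
    ring

/-- `{h₁, h₂}` is a Gröbner basis, with respect to `<_{-1}`, of the solution module, such that
the leading monomial of `h₁` is on the left and that of `h₂` is on the right. -/
def IsSolBasis (t : ℕ) (S : K[X]) (h₁ h₂ : K[X] × K[X]) : Prop :=
  IsGroebnerBasis (-1) (solModule t S) {h₁, h₂} ∧
    (∃ j, IsLeadingMonomial (-1) h₁ (Sum.inl j)) ∧ (∃ j, IsLeadingMonomial (-1) h₂ (Sum.inr j))

/-- The set of all `Q ∈ K[X, Y, Z]`, `(Y, Z)`-homogeneous of degree `ρ`, whose multiplicity at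
`(x², ĥ₂(x), ĥ₁(x))` is at least `m_{x⁻¹}`, for all `x ∈ K*`; here `ĥᵢ = μ(hᵢ)`. -/
def interpModule (h₁ h₂ : K[X] × K[X]) (m : Kˣ → ℕ) (ρ : ℕ) : Set (MvPolynomial (Fin 3) K) :=
  {Q | Q ∈ homog K ρ ∧ ∀ x : Kˣ,
    (m x⁻¹ : ℕ∞) ≤ mult Q ![(x : K) ^ 2, (mu h₂).eval (x : K), (mu h₁).eval (x : K)]}

/-- The image of `interpModule` under de-homogenization. -/
def interpModuleDehomog (h₁ h₂ : K[X] × K[X]) (m : Kˣ → ℕ) (ρ : ℕ) :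
    Set (MvPolynomial (Fin 2) K) :=
  dehomog '' interpModule h₁ h₂ m ρ

/-- `Q` is a non-zero element of `V` of minimal `(1, w)`-weighted degree among all non-zero
elements of `V`. -/
def IsMinimizer (w : ℚ) (V : Set (MvPolynomial (Fin 2) K)) (Q : MvPolynomial (Fin 2) K) : Prop :=
  Q ∈ V ∧ Q ≠ 0 ∧ ∀ P ∈ V, P ≠ 0 → wdeg ![1, w] Q ≤ wdeg ![1, w] P

end Solution

end BinaryBCH

/-!
By assumption `σ = f₁(X²) ĥ₁ + f₂(X²) ĥ₂`. At an inverse error location `x = α⁻¹` the polynomial `σ`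
vanishes, so the vectors `(ĥ₂(x), ĥ₁(x))` and `(-f₁(x²), f₂(x²))` are proportional: `f₁` and `f₂`
are coprime because `σ` is squarefree, and `ĥ₁`, `ĥ₂` have no common zero in `K*` because
`(0, X ^ t)` lies in the solution module. Hence a `(Y, Z)`-homogeneous `R` of multiplicity `m_α` at
`(x², ĥ₂(x), ĥ₁(x))` gives a univariate polynomial `R(X, -f₁, f₂)` divisible by `(X - x²) ^ m_α`.
The summands `f₁(X²) ĥ₁` and `f₂(X²) ĥ₂` of `σ` have odd and even degree, so neither degree exceeds
that of `σ`, which bounds the degrees of `f₁` and `f₂`. Comparing the number of linear conditions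
with the number of monomials, the minimal `(1, w)`-weighted degree is so small that `R(X, -f₁, f₂)`
has degree less than `∑_{α ∈ I} m_α`, hence vanishes. By homogeneity and coprimality of `f₁` and
`f₂` this means that `Y f₂ + f₁` divides `R(X, Y, 1)`.

Multiplicity `m` at `(x, y, z)` costs only `m (m + 1) / 2` conditions, not `m (m + 1) (m + 2) / 6`:
by homogeneity a linear change of `(Y, Z)` moves `(y, z)` to `(0, 1)`, where `Z` can be set to `1`.
-/

namespace BinaryBCH

section Multiplicity

variable {K : Type*} [Field K] {n : ℕ}

/-- The Taylor shift `g(X) ↦ g(a + X)`, whose coefficients are the values of the Hasse derivatives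
of `g` at `a`. -/
noncomputable def shift (a : Fin n → K) : MvPolynomial (Fin n) K →ₐ[K] MvPolynomial (Fin n) K :=
  MvPolynomial.aeval fun i => MvPolynomial.C (a i) + MvPolynomial.X i

theorem eval_hasse (d : Fin n →₀ ℕ) (g : MvPolynomial (Fin n) K) (a : Fin n → K) :
    MvPolynomial.eval a (hasse d g) = (shift a g).coeff d := by
  have hshift : shift a g = MvPolynomial.map (MvPolynomial.eval a) (MvPolynomial.aeval
      (fun i => (MvPolynomial.C (MvPolynomial.X i) + MvPolynomial.X i :
        MvPolynomial (Fin n) (MvPolynomial (Fin n) K))) g) := by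
    induction g using MvPolynomial.induction_on with
    | C c =>
      simp only [shift, MvPolynomial.algHom_C, MvPolynomial.algebraMap_eq]
      rw [IsScalarTower.algebraMap_apply K (MvPolynomial (Fin n) K)]
      simp [MvPolynomial.algebraMap_eq]
    | add p q hp hq => simp only [map_add, hp, hq]
    | mul_X p i hp => simp only [map_mul, hp]; simp [shift]
  rw [hshift, MvPolynomial.coeff_map, hasse]

theorem le_mult_iff {g : MvPolynomial (Fin n) K} {a : Fin n → K} {m : ℕ} :
    (m : ℕ∞) ≤ mult g a ↔ shift a g ∈ MvPolynomial.idealOfVars (Fin n) K ^ m := by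
  simp only [MvPolynomial.mem_pow_idealOfVars_iff', mult, le_iInf_iff, eval_hasse, Nat.cast_le]
  exact forall_congr' fun d => by rw [← not_imp_not, not_le, not_not]

theorem aeval_mem_pow_of_le_mult {A : Type*} [CommRing A] [Algebra K A]
    {g : MvPolynomial (Fin n) K} {a : Fin n → K} {m : ℕ} (hg : (m : ℕ∞) ≤ mult g a)
    {𝔞 : Ideal A} {p : Fin n → A} (hp : ∀ i, p i - algebraMap K A (a i) ∈ 𝔞) :
    MvPolynomial.aeval p g ∈ 𝔞 ^ m := by
  let φ : MvPolynomial (Fin n) K →ₐ[K] A := MvPolynomial.aeval fun i => p i - algebraMap K A (a i)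
  have hφ : MvPolynomial.aeval p = φ.comp (shift a) := by
    ext i
    simp [φ, shift]
  have hvars : (MvPolynomial.idealOfVars (Fin n) K).map φ ≤ 𝔞 := by
    rw [MvPolynomial.idealOfVars, Ideal.map_span, Ideal.span_le]
    rintro _ ⟨_, ⟨i, rfl⟩, rfl⟩
    simpa [φ] using hp i
  rw [hφ, AlgHom.comp_apply]
  refine Ideal.pow_right_mono hvars m ?_
  rw [← Ideal.map_pow]
  exact Ideal.mem_map_of_mem _ (le_mult_iff.1 hg)

theorem X_sub_C_pow_dvd_aeval_of_le_mult {g : MvPolynomial (Fin n) K} {a : Fin n → K} {m : ℕ}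
    (hg : (m : ℕ∞) ≤ mult g a) {p : Fin n → K[X]} {x : K} (hp : ∀ i, (p i).eval x = a i) :
    (X - C x) ^ m ∣ MvPolynomial.aeval p g := by
  rw [← Ideal.mem_span_singleton, ← Ideal.span_singleton_pow]
  refine aeval_mem_pow_of_le_mult hg fun i => ?_
  rw [Ideal.mem_span_singleton, algebraMap_eq, ← hp i]
  exact X_sub_C_dvd_sub_C_eval

end Multiplicity

section Homogeneous

theorem isWeightedHomogeneous_aeval {R σ τ M : Type*} [CommSemiring R] [AddCommMonoid M]
    {w : σ → M} {w' : τ → M} {L : σ → MvPolynomial τ R}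
    (hL : ∀ i, (L i).IsWeightedHomogeneous w' (w i)) {p : MvPolynomial σ R} {n : M}
    (hp : p.IsWeightedHomogeneous w n) :
    (MvPolynomial.aeval L p).IsWeightedHomogeneous w' n := by
  rw [MvPolynomial.aeval_def, MvPolynomial.eval₂_eq]
  refine MvPolynomial.IsWeightedHomogeneous.sum _ _ _ fun d hd => ?_
  rw [← hp (MvPolynomial.mem_support_iff.1 hd), Finsupp.weight_apply, Finsupp.sum]
  exact (MvPolynomial.IsWeightedHomogeneous.prod d.support _ _ fun i _ => (hL i).pow (d i)).C_mul _

variable {K : Type*} [Field K] {ρ : ℕ} {R : MvPolynomial (Fin 3) K}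

theorem mem_homog_iff_isWeightedHomogeneous :
    R ∈ homog K ρ ↔ R.IsWeightedHomogeneous (![0, 1, 1] : Fin 3 → ℕ) ρ := by
  refine forall_congr' fun d => ?_
  rw [MvPolynomial.mem_support_iff]
  simp [Finsupp.weight_apply, Finsupp.sum_fintype, Fin.sum_univ_three]

theorem aeval_mul_of_mem_homog {A : Type*} [CommSemiring A] [Algebra K A] (hR : R ∈ homog K ρ)
    (a c u v : A) :
    MvPolynomial.aeval ![a, c * u, c * v] R = c ^ ρ * MvPolynomial.aeval ![a, u, v] R := by
  simp only [MvPolynomial.aeval_def, MvPolynomial.eval₂_eq', Finset.mul_sum]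
  refine Finset.sum_congr rfl fun d hd => ?_
  simp only [Fin.prod_univ_three, Matrix.cons_val, mul_pow, ← hR d hd, pow_add]
  ring

/-- The exponent of the monomial `X ^ i Y ^ j` which de-homogenization makes out of
`X ^ i Y ^ j Z ^ k`. -/
noncomputable def xyExponent (d : Fin 3 →₀ ℕ) : Fin 2 →₀ ℕ :=
  Finsupp.equivFunOnFinite.symm ![d 0, d 1]

theorem dehomog_eq_sum_monomial (R : MvPolynomial (Fin 3) K) :
    dehomog R = ∑ d ∈ R.support, MvPolynomial.monomial (xyExponent d) (R.coeff d) := by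
  rw [dehomog, MvPolynomial.aeval_def, MvPolynomial.eval₂_eq']
  refine Finset.sum_congr rfl fun d _ => ?_
  rw [MvPolynomial.monomial_eq, Finsupp.prod_fintype _ _ fun _ => pow_zero _]
  simp [Fin.prod_univ_three, xyExponent, MvPolynomial.algebraMap_eq]

theorem injOn_xyExponent (hR : R ∈ homog K ρ) : Set.InjOn xyExponent R.support := by
  intro d hd d' hd' h
  have h0 : d 0 = d' 0 := by simpa [xyExponent] using DFunLike.congr_fun h 0
  have h1 : d 1 = d' 1 := by simpa [xyExponent] using DFunLike.congr_fun h 1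
  have := hR d hd
  have := hR d' hd'
  ext i
  fin_cases i <;> simp only [Fin.zero_eta, Fin.mk_one, Fin.reduceFinMk] <;> omega

theorem coeff_dehomog (hR : R ∈ homog K ρ) {d : Fin 3 →₀ ℕ} (hd : d ∈ R.support) :
    (dehomog R).coeff (xyExponent d) = R.coeff d := by
  rw [dehomog_eq_sum_monomial, MvPolynomial.coeff_sum, Finset.sum_eq_single_of_mem d hd]
  · simp
  · intro d' hd' hne
    rw [MvPolynomial.coeff_monomial, if_neg fun h => hne (injOn_xyExponent hR hd' hd h)]

theorem support_dehomog (hR : R ∈ homog K ρ) :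
    (dehomog R).support = R.support.image xyExponent := by
  ext e
  simp only [Finset.mem_image]
  constructor
  · rw [MvPolynomial.mem_support_iff, dehomog_eq_sum_monomial, MvPolynomial.coeff_sum]
    intro h
    obtain ⟨d, hd, hne⟩ := Finset.exists_ne_zero_of_sum_ne_zero h
    exact ⟨d, hd, by_contra fun h => hne ((MvPolynomial.coeff_monomial ..).trans (if_neg h))⟩
  · rintro ⟨d, hd, rfl⟩
    rw [MvPolynomial.mem_support_iff, coeff_dehomog hR hd]
    exact MvPolynomial.mem_support_iff.1 hd

theorem dehomog_ne_zero (hR : R ∈ homog K ρ) (h : R ≠ 0) : dehomog R ≠ 0 := by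
  rw [← MvPolynomial.support_nonempty] at h ⊢
  rw [support_dehomog hR]
  exact h.image _

theorem wdeg_dehomog_lt_iff (hR : R ∈ homog K ρ) {w Δ : ℚ} :
    wdeg ![1, w] (dehomog R) < (Δ : WithBot ℚ) ↔ ∀ d ∈ R.support, (d 0 : ℚ) + w * d 1 < Δ := by
  rw [wdeg, Finset.sup_lt_iff (WithBot.bot_lt_coe Δ), support_dehomog hR, Finset.forall_mem_image]
  simp only [WithBot.coe_lt_coe]
  simp [xyExponent, Fin.sum_univ_two]

theorem dvd_dehomog_of_aeval_eq_zero (hR : R ∈ homog K ρ) {p q : K[X]} (hpq : IsCoprime p q)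
    (h : MvPolynomial.aeval ![X, -p, q] R = 0) :
    MvPolynomial.X 1 * inX q + inX p ∣ dehomog R := by
  obtain ⟨u, v, huv⟩ := hpq
  rw [← Ideal.mem_span_singleton, ← Ideal.Quotient.eq_zero_iff_mem]
  set 𝔯 := Ideal.span {MvPolynomial.X 1 * inX q + inX p}
  let φ : MvPolynomial (Fin 2) K →ₐ[K] _ := Ideal.Quotient.mkₐ K 𝔯
  let ψ : K[X] →ₐ[K] _ := φ.comp (Polynomial.aeval (MvPolynomial.X 0))
  have hψ (f : K[X]) : φ (inX f) = ψ f := rfl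
  set y := φ (MvPolynomial.X 1)
  have hlin : y * ψ q + ψ p = 0 := by
    rw [← hψ, ← hψ, ← map_mul, ← map_add]
    exact Ideal.Quotient.eq_zero_iff_mem.2 (Ideal.mem_span_singleton_self _)
  have hbez : ψ u * ψ p + ψ v * ψ q = 1 := by
    rw [← map_mul, ← map_mul, ← map_add, huv, map_one]
  have hy : (ψ v - ψ u * y) * ψ (-p) = y := by
    rw [map_neg]
    linear_combination y * hbez - ψ v * hlin
  have hone : (ψ v - ψ u * y) * ψ q = 1 := by
    linear_combination hbez - ψ u * hlin
  calc φ (dehomog R) = MvPolynomial.aeval ![ψ X, y, 1] R := by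
        rw [dehomog, ← AlgHom.comp_apply, MvPolynomial.comp_aeval]
        congr 2
        ext i
        fin_cases i <;> simp [ψ, y]
    _ = (ψ v - ψ u * y) ^ ρ * MvPolynomial.aeval ![ψ X, ψ (-p), ψ q] R := by
        rw [← aeval_mul_of_mem_homog hR, hy, hone]
    _ = (ψ v - ψ u * y) ^ ρ * ψ (MvPolynomial.aeval ![X, -p, q] R) := by
        rw [← AlgHom.comp_apply ψ, MvPolynomial.comp_aeval]
        congr 3
        ext i
        fin_cases i <;> rfl
    _ = 0 := by rw [h, map_zero, mul_zero]

end Homogeneous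

section Interpolation

variable {K : Type*} [Field K]

/-- The substitution `(X, Y, Z) ↦ (x + X, α Y + y Z, β Y + z Z)`, which moves the point
`(x, y, z)` to `(0, 0, 1)` and preserves `(Y, Z)`-homogeneity; it is invertible if
`α z - β y = 1`. -/
noncomputable def recenter (x y z α β : K) :
    MvPolynomial (Fin 3) K →ₐ[K] MvPolynomial (Fin 3) K :=
  MvPolynomial.aeval ![MvPolynomial.C x + MvPolynomial.X 0,
    MvPolynomial.C α * MvPolynomial.X 1 + MvPolynomial.C y * MvPolynomial.X 2,
    MvPolynomial.C β * MvPolynomial.X 1 + MvPolynomial.C z * MvPolynomial.X 2]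

theorem recenter_mem_homog {ρ : ℕ} {R : MvPolynomial (Fin 3) K} (hR : R ∈ homog K ρ)
    (x y z α β : K) : recenter x y z α β R ∈ homog K ρ := by
  rw [mem_homog_iff_isWeightedHomogeneous] at hR ⊢
  refine isWeightedHomogeneous_aeval (fun i => ?_) hR
  have hX := MvPolynomial.isWeightedHomogeneous_X K (![0, 1, 1] : Fin 3 → ℕ)
  fin_cases i
  · exact (MvPolynomial.isWeightedHomogeneous_C _ x).add (hX 0)
  · exact ((hX 1).C_mul α).add ((hX 2).C_mul y)
  · exact ((hX 1).C_mul β).add ((hX 2).C_mul z)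

theorem shift_eq_aeval_recenter {x y z α β : K} (hαβ : α * z - β * y = 1)
    (R : MvPolynomial (Fin 3) K) :
    shift ![x, y, z] R = MvPolynomial.aeval ![MvPolynomial.X 0,
      MvPolynomial.C z * MvPolynomial.X 1 - MvPolynomial.C y * MvPolynomial.X 2,
      1 - MvPolynomial.C β * MvPolynomial.X 1 + MvPolynomial.C α * MvPolynomial.X 2]
        (recenter x y z α β R) := by
  have hC : (MvPolynomial.C α * MvPolynomial.C z - MvPolynomial.C β * MvPolynomial.C y :
      MvPolynomial (Fin 3) K) = 1 := by
    rw [← map_mul, ← map_mul, ← map_sub, hαβ, map_one]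
  rw [recenter, ← AlgHom.comp_apply, MvPolynomial.comp_aeval, shift]
  congr 2
  ext1 i
  fin_cases i
  · simp [MvPolynomial.algebraMap_eq]
  · simp only [map_add, map_mul, MvPolynomial.algHom_C, MvPolynomial.algebraMap_eq,
      MvPolynomial.aeval_X, Fin.mk_one, Matrix.cons_val]
    linear_combination (-MvPolynomial.X 1) * hC
  · simp only [map_add, map_mul, MvPolynomial.algHom_C, MvPolynomial.algebraMap_eq,
      MvPolynomial.aeval_X, Fin.reduceFinMk, Matrix.cons_val]
    linear_combination (-MvPolynomial.X 2) * hC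

theorem le_mult_of_forall_mem_support_recenter {x y z α β : K} (hαβ : α * z - β * y = 1) {m : ℕ}
    {R : MvPolynomial (Fin 3) K}
    (hR : ∀ d ∈ (recenter x y z α β R).support, m ≤ d 0 + d 1) :
    (m : ℕ∞) ≤ mult R ![x, y, z] := by
  rw [le_mult_iff, shift_eq_aeval_recenter hαβ, MvPolynomial.aeval_def, MvPolynomial.eval₂_eq']
  have hX (i : Fin 3) : MvPolynomial.X i ∈ MvPolynomial.idealOfVars (Fin 3) K :=
    Ideal.subset_span ⟨i, rfl⟩
  refine Ideal.sum_mem _ fun d hd => Ideal.mul_mem_left _ _ ?_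
  simp only [Fin.prod_univ_three, Matrix.cons_val]
  refine Ideal.mul_mem_right _ _ (Ideal.pow_le_pow_right (hR d hd) ?_)
  rw [pow_add]
  exact Ideal.mul_mem_mul (Ideal.pow_mem_pow (hX 0) _) (Ideal.pow_mem_pow
    (Ideal.sub_mem _ (Ideal.mul_mem_left _ _ (hX 1)) (Ideal.mul_mem_left _ _ (hX 2))) _)

theorem exists_mul_sub_mul_eq_one {y z : K} (hyz : y ≠ 0 ∨ z ≠ 0) :
    ∃ α β : K, α * z - β * y = 1 := by
  rcases hyz with h | h
  · exact ⟨0, -y⁻¹, by simp [h]⟩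
  · exact ⟨z⁻¹, 0, by simp [h]⟩

theorem exists_linear_conditions_le_mult (ρ m : ℕ) (x : K) {y z : K} (hyz : y ≠ 0 ∨ z ≠ 0) :
    ∃ ℓ : (Σ i : Fin m, Fin (i + 1)) → MvPolynomial (Fin 3) K →ₗ[K] K,
      ∀ R ∈ homog K ρ, (∀ k, ℓ k R = 0) → (m : ℕ∞) ≤ mult R ![x, y, z] := by
  obtain ⟨α, β, hαβ⟩ := exists_mul_sub_mul_eq_one hyz
  let exponent (k : Σ i : Fin m, Fin (i + 1)) : Fin 3 →₀ ℕ :=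
    Finsupp.equivFunOnFinite.symm ![k.2, k.1 - k.2, ρ - (k.1 - k.2)]
  refine ⟨fun k => MvPolynomial.lcoeff K (exponent k) ∘ₗ (recenter x y z α β).toLinearMap,
    fun R hR hℓ => le_mult_of_forall_mem_support_recenter hαβ fun d hd => ?_⟩
  by_contra! hlt
  have hd' : exponent ⟨⟨d 0 + d 1, hlt⟩, ⟨d 0, by simp only; omega⟩⟩ = d := by
    have := recenter_mem_homog hR x y z α β d hd
    ext i
    fin_cases i
    · simp [exponent]
    · simp [exponent]
    · simp only [exponent, Finsupp.equivFunOnFinite_symm_apply_apply, Fin.reduceFinMk,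
        Matrix.cons_val]
      omega
  refine MvPolynomial.mem_support_iff.1 hd ?_
  rw [← hd']
  exact hℓ _

theorem two_mul_card_sigma_fin_succ (m : ℕ) :
    2 * Fintype.card (Σ i : Fin m, Fin (i + 1)) = m * (m + 1) := by
  simp only [Fintype.card_sigma, Fintype.card_fin]
  rw [Fin.sum_univ_eq_sum_range (fun i => i + 1) m, mul_comm 2, ← Nat.add_zero (∑ _ ∈ _, _),
    ← Finset.sum_range_succ' (fun i => i), Finset.sum_range_id_mul_two, Nat.add_sub_cancel,
    mul_comm]

/-- The exponents of the monomials `X ^ i Y ^ j Z ^ (ρ - j)`, `j ≤ ρ`, for which `X ^ i Y ^ j`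
has `(1, w)`-weighted degree less than `Δ`. -/
noncomputable def lowExponents (ρ : ℕ) (w Δ : ℚ) : Finset (Fin 3 →₀ ℕ) :=
  ((Finset.range (ρ + 1)).sigma fun j => Finset.range ⌈Δ - w * j⌉₊).map
    ⟨fun k => Finsupp.equivFunOnFinite.symm ![k.2, k.1, ρ - k.1], fun k l h => by
      have h0 := DFunLike.congr_fun h 0
      have h1 := DFunLike.congr_fun h 1
      exact Sigma.ext (by simpa using h1) (heq_of_eq (by simpa using h0))⟩

theorem mem_lowExponents {ρ : ℕ} {w Δ : ℚ} {d : Fin 3 →₀ ℕ} (hd : d ∈ lowExponents ρ w Δ) :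
    d 1 + d 2 = ρ ∧ (d 0 : ℚ) + w * d 1 < Δ := by
  simp only [lowExponents, Finset.mem_map, Finset.mem_sigma, Finset.mem_range] at hd
  obtain ⟨⟨j, i⟩, ⟨hj, hi⟩, rfl⟩ := hd
  rw [Nat.lt_ceil, lt_sub_iff_add_lt] at hi
  exact ⟨Nat.add_sub_of_le (Nat.lt_succ_iff.1 hj), hi⟩

theorem le_card_lowExponents (ρ : ℕ) (w Δ : ℚ) :
    (ρ + 1) * (Δ - ρ * w / 2) ≤ (lowExponents ρ w Δ).card := by
  have hgauss : ∑ j ∈ Finset.range (ρ + 1), (j : ℚ) = (ρ + 1) * ρ / 2 := by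
    rw [eq_div_iff two_ne_zero, ← Nat.cast_sum]
    exact_mod_cast Finset.sum_range_id_mul_two (ρ + 1)
  calc (ρ + 1) * (Δ - ρ * w / 2) = ∑ j ∈ Finset.range (ρ + 1), (Δ - w * j) := by
        rw [Finset.sum_sub_distrib, ← Finset.mul_sum, hgauss, Finset.sum_const, Finset.card_range,
          nsmul_eq_mul, Nat.cast_succ]
        ring
    _ ≤ ∑ j ∈ Finset.range (ρ + 1), (⌈Δ - w * j⌉₊ : ℚ) := by gcongr; exact Nat.le_ceil _
    _ = (lowExponents ρ w Δ).card := by simp [lowExponents]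

theorem exists_mem_homog_of_sum_lt {ι : Type*} (T : Finset ι) (x y z : ι → K)
    (hyz : ∀ k ∈ T, y k ≠ 0 ∨ z k ≠ 0) (m : ι → ℕ) (ρ : ℕ) (w Δ : ℚ)
    (hcount : ∑ k ∈ T, (m k : ℚ) * (m k + 1) < 2 * (ρ + 1) * (Δ - ρ * w / 2)) :
    ∃ R ∈ homog K ρ, R ≠ 0 ∧ wdeg ![1, w] (dehomog R) < (Δ : WithBot ℚ) ∧
      ∀ k ∈ T, (m k : ℕ∞) ≤ mult R ![x k, y k, z k] := by
  choose ℓ hℓ using fun k : T => exists_linear_conditions_le_mult ρ (m k) (x k) (hyz k k.2)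
  let V := MvPolynomial.restrictSupport K (lowExponents ρ w Δ : Set (Fin 3 →₀ ℕ))
  let F : V →ₗ[K] (Σ k : T, Σ i : Fin (m k), Fin (i + 1)) → K :=
    LinearMap.pi fun k => (ℓ k.1 k.2).comp V.subtype
  let basis := MvPolynomial.basisRestrictSupport K (lowExponents ρ w Δ : Set (Fin 3 →₀ ℕ))
  have : Module.Finite K V := Module.Finite.of_basis basis
  have hrank : Module.finrank K ((Σ k : T, Σ i : Fin (m k), Fin (i + 1)) → K) <
      Module.finrank K V := by
    have hconditions : ((2 * Fintype.card (Σ k : T, Σ i : Fin (m k), Fin (i + 1)) : ℕ) : ℚ) =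
        ∑ k ∈ T, (m k : ℚ) * (m k + 1) := by
      rw [Fintype.card_sigma, Finset.mul_sum]
      simp only [two_mul_card_sigma_fin_succ]
      rw [Finset.sum_coe_sort T fun k => m k * (m k + 1)]
      push_cast
      rfl
    rw [Module.finrank_pi, Module.finrank_eq_card_basis basis, ← Nat.cast_lt (α := ℚ)]
    refine lt_of_lt_of_le ?_ ((le_card_lowExponents ρ w Δ).trans_eq (by simp))
    push_cast at hconditions
    linarith
  obtain ⟨⟨R, hRV⟩, hR, hR0⟩ := Submodule.exists_mem_ne_zero_of_ne_bot
    (LinearMap.ker_ne_bot_of_finrank_lt (f := F) hrank)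
  have hlow (d) (hd : d ∈ R.support) := mem_lowExponents (hRV hd)
  have hRhom : R ∈ homog K ρ := fun d hd => (hlow d hd).1
  refine ⟨R, hRhom, fun h => hR0 (Subtype.ext h),
    (wdeg_dehomog_lt_iff hRhom).2 fun d hd => (hlow d hd).2, fun k hk => ?_⟩
  exact hℓ ⟨k, hk⟩ R hRhom fun l => congrFun hR ⟨⟨k, hk⟩, l⟩

end Interpolation

section SolutionBasis

variable {K : Type*} [Field K]

theorem mu_apply (p : K[X] × K[X]) : mu p = expand K 2 p.2 + X * expand K 2 p.1 := rfl

theorem mu_smul (c : K[X]) (p : K[X] × K[X]) : mu (c • p) = expand K 2 c * mu p := by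
  simp only [mu_apply, Prod.smul_fst, Prod.smul_snd, smul_eq_mul, map_mul]
  ring

/-- The degree of the image under `mu` of a monomial of `K[X]²`; by `monLT_neg_one_iff` it turns
the ordering `<_{-1}` into the ordering by degree. -/
def monExp : ℕ ⊕ ℕ → ℕ
  | Sum.inl j => 2 * j + 1
  | Sum.inr j => 2 * j

theorem coeff_mu_monExp (p : K[X] × K[X]) (a : ℕ ⊕ ℕ) :
    (mu p).coeff (monExp a) = monCoeff p a := by
  cases a with
  | inl j =>
    rw [monExp, ← coeff_oddPart]
    exact congrArg (fun r : K[X] × K[X] => r.1.coeff j) (mu.symm_apply_apply p)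
  | inr j =>
    rw [monExp, ← coeff_evenPart]
    exact congrArg (fun r : K[X] × K[X] => r.2.coeff j) (mu.symm_apply_apply p)

theorem surjective_monExp : Function.Surjective monExp := by
  intro k
  obtain ⟨j, rfl | rfl⟩ := Nat.even_or_odd' k
  exacts [⟨Sum.inr j, rfl⟩, ⟨Sum.inl j, rfl⟩]

theorem monLT_neg_one_iff {a b : ℕ ⊕ ℕ} : monLT (-1) a b ↔ monExp a < monExp b := by
  rcases a with i | i <;> rcases b with j | j <;> simp only [monLT, monExp]
  · omega
  · rw [← sub_eq_add_neg, le_sub_iff_add_le]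
    norm_cast
    omega
  · rw [← sub_eq_add_neg, sub_lt_iff_lt_add]
    norm_cast
    omega
  · omega

variable {p g : K[X] × K[X]}

theorem IsLeadingMonomial.monCoeff_eq_zero {a b : ℕ ⊕ ℕ} (h : IsLeadingMonomial (-1) p a)
    (hab : monExp a < monExp b) : monCoeff p b = 0 := by
  by_contra hb
  exact hab.asymm (monLT_neg_one_iff.1 (h.2 b hb fun hba => hab.ne' (congrArg monExp hba)))

theorem IsLeadingMonomial.degree_mu {a : ℕ ⊕ ℕ} (h : IsLeadingMonomial (-1) p a) :
    (mu p).degree = monExp a := by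
  refine le_antisymm ((degree_le_iff_coeff_zero _ _).2 fun k hk => ?_) (le_degree_of_ne_zero ?_)
  · obtain ⟨b, rfl⟩ := surjective_monExp k
    rw [coeff_mu_monExp]
    exact h.monCoeff_eq_zero (Nat.cast_lt.1 hk)
  · rw [coeff_mu_monExp]
    exact h.1

theorem IsLeadingMonomial.mu_ne_zero {a : ℕ ⊕ ℕ} (h : IsLeadingMonomial (-1) p a) : mu p ≠ 0 := by
  rw [← degree_ne_bot, h.degree_mu]
  exact WithBot.coe_ne_bot

theorem IsLeadingMonomial.degree_of_inl {a : ℕ} (h : IsLeadingMonomial (-1) p (Sum.inl a)) :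
    p.1.degree = a ∧ p.2.degree ≤ a := by
  refine ⟨le_antisymm ((degree_le_iff_coeff_zero _ _).2 fun k hk => ?_) (le_degree_of_ne_zero h.1),
    (degree_le_iff_coeff_zero _ _).2 fun k hk => ?_⟩
  all_goals rw [Nat.cast_lt] at hk
  · exact h.monCoeff_eq_zero (b := Sum.inl k) (by simp only [monExp]; omega)
  · exact h.monCoeff_eq_zero (b := Sum.inr k) (by simp only [monExp]; omega)

theorem IsLeadingMonomial.degree_of_inr {b : ℕ} (h : IsLeadingMonomial (-1) p (Sum.inr b)) :
    p.2.degree = b ∧ p.1.degree < b := by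
  refine ⟨le_antisymm ((degree_le_iff_coeff_zero _ _).2 fun k hk => ?_) (le_degree_of_ne_zero h.1),
    (degree_lt_iff_coeff_zero _ _).2 fun k hk => ?_⟩
  · rw [Nat.cast_lt] at hk
    exact h.monCoeff_eq_zero (b := Sum.inr k) (by simp only [monExp]; omega)
  · exact h.monCoeff_eq_zero (b := Sum.inl k) (by simp only [monExp]; omega)

theorem exists_monExp_eq_of_monDvd {a b : ℕ ⊕ ℕ} (hab : monDvd a b) :
    ∃ k, monExp b = 2 * k + monExp a := by
  rcases a with i | i <;> rcases b with j | j <;> simp only [monDvd] at hab <;>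
    exact ⟨j - i, by simp only [monExp]; omega⟩

theorem exists_degree_mu_sub_smul_lt {a b : ℕ ⊕ ℕ} (ha : IsLeadingMonomial (-1) g a)
    (hb : IsLeadingMonomial (-1) p b) (hab : monDvd a b) :
    ∃ c : K[X], (mu (p - c • g)).degree < (mu p).degree := by
  obtain ⟨k, hk⟩ := exists_monExp_eq_of_monDvd hab
  have hlead : (mu g).leadingCoeff ≠ 0 := leadingCoeff_ne_zero.2 ha.mu_ne_zero
  set r := (mu p).leadingCoeff / (mu g).leadingCoeff
  have hr : r ≠ 0 := div_ne_zero (leadingCoeff_ne_zero.2 hb.mu_ne_zero) hlead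
  have hmu : mu ((C r * X ^ k) • g) = C r * X ^ (2 * k) * mu g := by
    rw [mu_smul, map_mul, expand_C, map_pow, expand_X, pow_mul]
  refine ⟨C r * X ^ k, ?_⟩
  rw [map_sub]
  refine degree_sub_lt_left ?_ hb.mu_ne_zero ?_
  · rw [hmu, degree_mul, degree_C_mul_X_pow _ hr, ha.degree_mu, hb.degree_mu, hk, Nat.cast_add]
  · rw [hmu, leadingCoeff_mul, leadingCoeff_C_mul_X_pow, div_mul_cancel₀ _ hlead]

theorem IsGroebnerBasis.le_span {N : Submodule K[X] (K[X] × K[X])} {G : Set (K[X] × K[X])}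
    (hG : IsGroebnerBasis (-1) N G) : N ≤ Submodule.span K[X] G := by
  intro p hp
  induction hd : (mu p).degree using WellFoundedLT.induction generalizing p with
  | ind d ih =>
    subst hd
    rcases eq_or_ne p 0 with rfl | hp0
    · exact Submodule.zero_mem _
    obtain ⟨g, hg, a, b, ha, hb, hab⟩ := hG.2.2 p hp hp0
    obtain ⟨c, hc⟩ := exists_degree_mu_sub_smul_lt ha hb hab
    rw [← sub_add_cancel p (c • g)]
    exact Submodule.add_mem _ (ih _ hc (N.sub_mem hp (N.smul_mem c (hG.2.1 hg))) rfl)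
      (Submodule.smul_mem _ c (Submodule.subset_span hg))

theorem zero_X_pow_mem_solModule (t : ℕ) (S : K[X]) :
    ((0, X ^ t) : K[X] × K[X]) ∈ solModule t S := by
  change (PowerSeries.X : PowerSeries K) ^ t ∣
    ((0 : K[X]) : PowerSeries K) - modifiedSyndrome S * ((X ^ t : K[X]) : PowerSeries K)
  rw [Polynomial.coe_zero, zero_sub, dvd_neg, Polynomial.coe_pow, Polynomial.coe_X]
  exact dvd_mul_left _ _

variable {t : ℕ} {S : K[X]} {h₁ h₂ : K[X] × K[X]}

theorem X_pow_dvd_det_of_mem_solModule (m₁ : h₁ ∈ solModule t S) (m₂ : h₂ ∈ solModule t S) :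
    X ^ t ∣ h₁.1 * h₂.2 - h₁.2 * h₂.1 := by
  rw [X_pow_dvd_iff]
  simp_rw [← Polynomial.coeff_coe]
  rw [← PowerSeries.X_pow_dvd_iff]
  convert dvd_sub (Dvd.dvd.mul_right m₁ (h₂.2 : PowerSeries K))
    (Dvd.dvd.mul_right m₂ (h₁.2 : PowerSeries K)) using 1
  push_cast
  ring

theorem IsSolBasis.eval_mu_ne_zero (h : IsSolBasis t S h₁ h₂) {x : K} (hx : x ≠ 0) :
    (mu h₂).eval x ≠ 0 ∨ (mu h₁).eval x ≠ 0 := by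
  by_contra! hzero
  obtain ⟨c₁, c₂, hc⟩ :=
    Submodule.mem_span_pair.1 (h.1.le_span (zero_X_pow_mem_solModule t S))
  have heval := congrArg (fun q => (mu q).eval x) hc
  simp only [map_add, mu_smul, eval_add, eval_mul, hzero, mul_zero, add_zero] at heval
  exact pow_ne_zero t (pow_ne_zero 2 hx) (by simpa [mu_apply] using heval.symm)

theorem IsSolBasis.natDegree_mu_left (h : IsSolBasis t S h₁ h₂) :
    (mu h₁).natDegree = 2 * h₁.1.natDegree + 1 := by
  obtain ⟨a, ha⟩ := h.2.1
  rw [natDegree_eq_of_degree_eq_some ha.degree_mu,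
    natDegree_eq_of_degree_eq_some ha.degree_of_inl.1, monExp]

theorem IsSolBasis.natDegree_mu_right (h : IsSolBasis t S h₁ h₂) :
    (mu h₂).natDegree = 2 * h₂.2.natDegree := by
  obtain ⟨b, hb⟩ := h.2.2
  rw [natDegree_eq_of_degree_eq_some hb.degree_mu,
    natDegree_eq_of_degree_eq_some hb.degree_of_inr.1, monExp]

theorem IsSolBasis.le_natDegree_add_natDegree (h : IsSolBasis t S h₁ h₂) :
    t ≤ h₁.1.natDegree + h₂.2.natDegree := by
  obtain ⟨⟨-, hmem, -⟩, ⟨a, ha⟩, b, hb⟩ := h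
  obtain ⟨h₁₁, h₁₂⟩ := ha.degree_of_inl
  obtain ⟨h₂₂, h₂₁⟩ := hb.degree_of_inr
  have hdeg : (h₁.1 * h₂.2 - h₁.2 * h₂.1).degree = (a + b : ℕ) := by
    rw [degree_sub_eq_left_of_degree_lt, degree_mul, h₁₁, h₂₂, Nat.cast_add]
    rw [degree_mul, degree_mul, h₁₁, h₂₂]
    exact (add_le_add_left h₁₂ _).trans_lt (WithBot.add_lt_add_left WithBot.coe_ne_bot h₂₁)
  have hdvd := X_pow_dvd_det_of_mem_solModule (hmem (Set.mem_insert h₁ _))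
    (hmem (Set.mem_insert_of_mem h₁ rfl))
  have hle := degree_le_of_dvd hdvd
    (by rw [← degree_ne_bot, hdeg]; exact WithBot.coe_ne_bot)
  rw [degree_X_pow, hdeg, Nat.cast_le] at hle
  rwa [natDegree_eq_of_degree_eq_some h₁₁, natDegree_eq_of_degree_eq_some h₂₂]

theorem natDegree_mu_smul {c : K[X]} (hc : c ≠ 0) (hp : mu p ≠ 0) :
    (mu (c • p)).natDegree = 2 * c.natDegree + (mu p).natDegree := by
  rw [mu_smul, natDegree_mul ((expand_ne_zero two_pos).2 hc) hp, natDegree_expand, mul_comm]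

theorem natDegree_le_natDegree_add {p q : K[X]} (h : q = 0 ∨ p.natDegree ≠ q.natDegree) :
    p.natDegree ≤ (p + q).natDegree := by
  rcases h with rfl | h
  · rw [add_zero]
  rcases lt_or_gt_of_ne h with h | h
  · exact h.le.trans (natDegree_add_eq_right_of_natDegree_lt h).ge
  · exact (natDegree_add_eq_left_of_natDegree_lt h).ge

theorem IsSolBasis.natDegree_mu_smul_ne (h : IsSolBasis t S h₁ h₂) {f₁ f₂ : K[X]} (hf₁ : f₁ ≠ 0)
    (hf₂ : f₂ ≠ 0) : (mu (f₁ • h₁)).natDegree ≠ (mu (f₂ • h₂)).natDegree := by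
  have := h.natDegree_mu_left
  have := h.natDegree_mu_right
  obtain ⟨-, ⟨a, ha⟩, b, hb⟩ := h
  rw [natDegree_mu_smul hf₁ ha.mu_ne_zero, natDegree_mu_smul hf₂ hb.mu_ne_zero]
  omega

theorem IsSolBasis.natDegree_left_le (h : IsSolBasis t S h₁ h₂) {f₁ : K[X]} (f₂ : K[X])
    (hf₁ : f₁ ≠ 0) : (f₁.natDegree : ℚ) ≤
      (mu (f₁ • h₁ + f₂ • h₂)).natDegree / 2 + h₂.2.natDegree - t - 1 / 2 := by
  have hle : (mu (f₁ • h₁)).natDegree ≤ (mu (f₁ • h₁ + f₂ • h₂)).natDegree := by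
    rw [map_add]
    refine natDegree_le_natDegree_add ((eq_or_ne f₂ 0).imp ?_ (h.natDegree_mu_smul_ne hf₁))
    rintro rfl
    rw [zero_smul, map_zero]
  have hdet := h.le_natDegree_add_natDegree
  have hmu := h.natDegree_mu_left
  obtain ⟨-, ⟨a, ha⟩, -⟩ := h
  rw [natDegree_mu_smul hf₁ ha.mu_ne_zero, hmu] at hle
  qify at hle hdet
  linarith

theorem IsSolBasis.natDegree_right_le (h : IsSolBasis t S h₁ h₂) (f₁ : K[X]) {f₂ : K[X]}
    (hf₂ : f₂ ≠ 0) :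
    (f₂.natDegree : ℚ) ≤ (mu (f₁ • h₁ + f₂ • h₂)).natDegree / 2 - h₂.2.natDegree := by
  have hle : (mu (f₂ • h₂)).natDegree ≤ (mu (f₁ • h₁ + f₂ • h₂)).natDegree := by
    rw [map_add, add_comm]
    refine natDegree_le_natDegree_add
      ((eq_or_ne f₁ 0).imp ?_ fun hf₁ => (h.natDegree_mu_smul_ne hf₁ hf₂).symm)
    rintro rfl
    rw [zero_smul, map_zero]
  have hmu := h.natDegree_mu_right
  obtain ⟨-, -, b, hb⟩ := h
  rw [natDegree_mu_smul hf₂ hb.mu_ne_zero, hmu] at hle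
  qify at hle
  linarith

end SolutionBasis

section Locator

variable {K : Type*} [Field K]

theorem natDegree_elp_le (I : Finset Kˣ) : (elp I).natDegree ≤ I.card := by
  refine (natDegree_prod_le _ _).trans ?_
  rw [Finset.card_eq_sum_ones]
  gcongr with α
  compute_degree

theorem isCoprime_one_add_C_mul_X {a b : K} (hab : a ≠ b) :
    IsCoprime (1 + C a * X) (1 + C b * X) := by
  have hC : C (b - a)⁻¹ * (C b - C a) = 1 := by
    rw [← C_sub, ← C_mul, inv_mul_cancel₀ (sub_ne_zero.2 hab.symm), C_1]
  exact ⟨C (b - a)⁻¹ * C b, -(C (b - a)⁻¹ * C a), by linear_combination hC⟩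

theorem separable_elp (I : Finset Kˣ) : (elp I).Separable := by
  refine separable_prod' (fun α _ β _ hne => isCoprime_one_add_C_mul_X (Units.val_injective.ne hne))
    fun α _ => ⟨1, -X, ?_⟩
  simp only [derivative_add, derivative_one, derivative_C_mul, derivative_X]
  ring

theorem eval_inv_elp [CharP K 2] {I : Finset Kˣ} {α : Kˣ} (hα : α ∈ I) :
    (elp I).eval ((α⁻¹ : Kˣ) : K) = 0 := by
  rw [elp, eval_prod]
  exact Finset.prod_eq_zero hα (by simp [CharTwo.add_self_eq_zero])

variable {h₁ h₂ : K[X] × K[X]} {f₁ f₂ : K[X]}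

theorem isCoprime_of_separable_mu [CharP K 2] (h : (mu (f₁ • h₁ + f₂ • h₂)).Separable) :
    IsCoprime f₁ f₂ := by
  refine IsRelPrime.isCoprime fun d hd₁ hd₂ => ?_
  have hd : expand K 2 d ∣ mu (f₁ • h₁ + f₂ • h₂) := by
    rw [map_add, mu_smul, mu_smul]
    exact dvd_add ((_root_.map_dvd _ hd₁).mul_right _) ((_root_.map_dvd _ hd₂).mul_right _)
  exact (isUnit_or_eq_zero_of_separable_expand 2 1 two_pos (h.of_dvd hd)).resolve_right one_ne_zero

theorem exists_eq_mul_of_isCoprime {A : Type*} [CommRing A] {a b y z : A} (hab : IsCoprime a b)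
    (h : a * z + b * y = 0) : ∃ c, y = c * -a ∧ z = c * b := by
  obtain ⟨u, v, huv⟩ := hab
  exact ⟨v * z - u * y, by linear_combination v * h - y * huv,
    by linear_combination u * h - z * huv⟩

theorem X_sub_C_sq_pow_dvd_aeval {x : K} (hcop : IsCoprime f₁ f₂)
    (hne : (mu h₂).eval x ≠ 0 ∨ (mu h₁).eval x ≠ 0)
    (hroot : (mu (f₁ • h₁ + f₂ • h₂)).eval x = 0) {ρ m : ℕ} {R : MvPolynomial (Fin 3) K}
    (hR : R ∈ homog K ρ)
    (hmult : (m : ℕ∞) ≤ mult R ![x ^ 2, (mu h₂).eval x, (mu h₁).eval x]) :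
    (X - C (x ^ 2)) ^ m ∣ MvPolynomial.aeval ![X, -f₁, f₂] R := by
  obtain ⟨c, hc₂, hc₁⟩ : ∃ c, (mu h₂).eval x = c * -f₁.eval (x ^ 2) ∧
      (mu h₁).eval x = c * f₂.eval (x ^ 2) := by
    refine exists_eq_mul_of_isCoprime (hcop.map (evalRingHom (x ^ 2))) ?_
    simpa only [map_add, mu_smul, eval_add, eval_mul, expand_eval] using hroot
  have hc : c ≠ 0 := by
    rintro rfl
    simp [hc₁, hc₂] at hne
  have hdvd : (X - C (x ^ 2)) ^ m ∣ MvPolynomial.aeval ![X, C c * -f₁, C c * f₂] R := by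
    refine X_sub_C_pow_dvd_aeval_of_le_mult hmult fun i => ?_
    fin_cases i <;> simp [hc₁, hc₂]
  rw [aeval_mul_of_mem_homog hR] at hdvd
  exact ((isUnit_C.2 hc.isUnit).pow ρ).dvd_mul_left.1 hdvd

end Locator

section ListDecoding

variable {K : Type*} [Field K]

theorem natDegree_pow_le_mul_of_ne_zero {p : K[X]} {c : ℚ} (hp : p ≠ 0 → (p.natDegree : ℚ) ≤ c)
    {n : ℕ} (hn : p ^ n ≠ 0) : ((p ^ n).natDegree : ℚ) ≤ n * c := by
  rcases eq_or_ne n 0 with rfl | h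
  · simp
  · rw [natDegree_pow, Nat.cast_mul]
    gcongr
    exact hp (ne_zero_pow h hn)

theorem degree_aeval_lt {ρ : ℕ} {R : MvPolynomial (Fin 3) K} (hR : R ∈ homog K ρ) {p q : K[X]}
    {w v Δ : ℚ} (hp : p ≠ 0 → (p.natDegree : ℚ) ≤ v + w) (hq : q ≠ 0 → (q.natDegree : ℚ) ≤ v)
    (hwdeg : wdeg ![1, w] (dehomog R) < (Δ : WithBot ℚ)) {D : ℕ} (hD : Δ + ρ * v ≤ D) :
    (MvPolynomial.aeval ![X, p, q] R).degree < D := by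
  rw [← mem_degreeLT, MvPolynomial.aeval_def, MvPolynomial.eval₂_eq']
  refine Submodule.sum_mem _ fun d hd => ?_
  rw [algebraMap_eq, ← smul_eq_C_mul]
  refine Submodule.smul_mem _ _ ?_
  simp only [Fin.prod_univ_three, Matrix.cons_val]
  by_cases hzero : X ^ d 0 * p ^ d 1 * q ^ d 2 = 0
  · rw [hzero]
    exact Submodule.zero_mem _
  have hpn := natDegree_pow_le_mul_of_ne_zero hp (right_ne_zero_of_mul (left_ne_zero_of_mul hzero))
  have hqn := natDegree_pow_le_mul_of_ne_zero hq (right_ne_zero_of_mul hzero)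
  rw [mem_degreeLT, degree_eq_natDegree hzero, Nat.cast_lt, ← Nat.cast_lt (α := ℚ),
    natDegree_mul (left_ne_zero_of_mul hzero) (right_ne_zero_of_mul hzero),
    natDegree_mul (by simp) (right_ne_zero_of_mul (left_ne_zero_of_mul hzero)), natDegree_X_pow]
  have hdρ : (d 1 + d 2 : ℚ) = ρ := by exact_mod_cast hR d hd
  calc ((d 0 + (p ^ d 1).natDegree + (q ^ d 2).natDegree : ℕ) : ℚ)
      ≤ d 0 + d 1 * (v + w) + d 2 * v := by push_cast; gcongr
    _ = d 0 + w * d 1 + ρ * v := by rw [← hdρ]; ring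
    _ < Δ + ρ * v := by gcongr; exact (wdeg_dehomog_lt_iff hR).1 hwdeg d hd
    _ ≤ D := hD

theorem eq_zero_of_X_sub_C_pow_dvd {ι : Type*} {T : Finset ι} {z : ι → K} (hz : Set.InjOn z T)
    {m : ι → ℕ} {g : K[X]} (hdvd : ∀ k ∈ T, (X - C (z k)) ^ m k ∣ g)
    (hdeg : g.degree < (∑ k ∈ T, m k : ℕ)) : g = 0 := by
  have hprod : ∏ k ∈ T, (X - C (z k)) ^ m k ∣ g :=
    Finset.prod_dvd_of_coprime (fun k hk l hl hkl => (isCoprime_X_sub_C_of_isUnit_sub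
      (sub_ne_zero.2 fun h => hkl (hz hk hl h)).isUnit).pow) hdvd
  refine eq_zero_of_dvd_of_degree_lt hprod (hdeg.trans_eq ?_)
  simp [degree_prod]

variable {t : ℕ} {S : K[X]} {h₁ h₂ : K[X] × K[X]}

theorem IsMinimizer.wdeg_lt (hbasis : IsSolBasis t S h₁ h₂) {J : Finset Kˣ} {m : Kˣ → ℕ}
    (hmJ : ∀ α ∉ J, m α = 0) {ρ : ℕ} {w Δ : ℚ}
    (hcount : ∑ α ∈ J, (m α : ℚ) * (m α + 1) < 2 * (ρ + 1) * (Δ - ρ * w / 2))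
    {Q : MvPolynomial (Fin 2) K} (hQ : IsMinimizer w (interpModuleDehomog h₁ h₂ m ρ) Q) :
    wdeg ![1, w] Q < (Δ : WithBot ℚ) := by
  obtain ⟨P, hPhom, hP, hPdeg, hPmult⟩ := exists_mem_homog_of_sum_lt J
    (fun α => ((α⁻¹ : Kˣ) : K) ^ 2) (fun α => (mu h₂).eval ((α⁻¹ : Kˣ) : K))
    (fun α => (mu h₁).eval ((α⁻¹ : Kˣ) : K)) (fun α _ => hbasis.eval_mu_ne_zero α⁻¹.ne_zero)
    m ρ w Δ hcount
  refine (hQ.2.2 _ ⟨P, ⟨hPhom, fun x => ?_⟩, rfl⟩ (dehomog_ne_zero hPhom hP)).trans_lt hPdeg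
  by_cases hx : x⁻¹ ∈ J
  · simpa using hPmult _ hx
  · simp [hmJ _ hx]

theorem sum_ite_mem_div_add_lt [DecidableEq K] {I J : Finset Kˣ} {m ρ : ℕ} {b : ℚ}
    (h : (m : ℚ) * ((I ∩ J).card : ℚ) >
      if Odd ρ then (J.card : ℚ) * (m * (m + 1)) / (2 * (ρ + 1)) + b
      else ((J.card : ℚ) * (m * (m + 1)) + 1) / (2 * (ρ + 1)) + b) :
    (∑ α ∈ J, ((if α ∈ J then m else 0 : ℕ) : ℚ) * ((if α ∈ J then m else 0 : ℕ) + 1)) /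
      (2 * (ρ + 1)) + b < ∑ α ∈ I, ((if α ∈ J then m else 0 : ℕ) : ℚ) := by
  have hI : ∑ α ∈ I, ((if α ∈ J then m else 0 : ℕ) : ℚ) = m * (I ∩ J).card := by
    simp [Finset.sum_ite_mem, mul_comm]
  rw [Finset.sum_congr rfl fun α hα => by rw [if_pos hα], Finset.sum_const, nsmul_eq_mul, hI]
  refine lt_of_le_of_lt ?_ h
  split_ifs
  · rfl
  · gcongr
    linarith

theorem inv_sq_injective [CharP K 2] : Function.Injective fun α : Kˣ => ((α⁻¹ : Kˣ) : K) ^ 2 :=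
  fun _ _ h => inv_injective (Units.ext (frobenius_inj K 2 h))

end ListDecoding

end BinaryBCH

open BinaryBCH in
theorem mainTheorem7_general {K : Type*} [Field K] [CharP K 2] {t : ℕ} {S : K[X]}
    {I J : Finset Kˣ} {h₁ h₂ : K[X] × K[X]} (hbasis : IsSolBasis t S h₁ h₂)
    {f₁ f₂ : K[X]} (hf : mu.symm (elp I) = f₁ • h₁ + f₂ • h₂)
    {m : Kˣ → ℕ} (hmJ : ∀ α ∉ J, m α = 0) {ρ : ℕ}
    {w : ℚ} (hw : w = 2 * (h₂.2.natDegree : ℚ) - t - 1 / 2)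
    (hlist : (∑ α ∈ J, (m α : ℚ) * (m α + 1)) / (2 * (ρ + 1)) +
      ρ / 2 * ((I.card : ℚ) - t - 1 / 2) < ∑ α ∈ I, (m α : ℚ))
    {Q : MvPolynomial (Fin 2) K}
    (hQ : IsMinimizer w (interpModuleDehomog h₁ h₂ m ρ) Q) :
    MvPolynomial.X 1 * inX f₂ + inX f₁ ∣ Q := by
  have hσ : mu (f₁ • h₁ + f₂ • h₂) = elp I := by
    rw [← hf, AddEquiv.apply_symm_apply]
  have hcop : IsCoprime f₁ f₂ :=
    isCoprime_of_separable_mu (hσ ▸ separable_elp I)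
  have hσdeg : ((mu (f₁ • h₁ + f₂ • h₂)).natDegree : ℚ) ≤ I.card :=
    mod_cast hσ ▸ natDegree_elp_le I
  have hf₁deg (h : -f₁ ≠ 0) : ((-f₁).natDegree : ℚ) ≤ I.card / 2 - h₂.2.natDegree + w := by
    rw [natDegree_neg]
    linarith [hbasis.natDegree_left_le f₂ (neg_ne_zero.1 h)]
  have hf₂deg (h : f₂ ≠ 0) : (f₂.natDegree : ℚ) ≤ I.card / 2 - h₂.2.natDegree := by
    linarith [hbasis.natDegree_right_le f₁ h]
  have hlist_Δ : (∑ α ∈ J, (m α : ℚ) * (m α + 1)) / (2 * (ρ + 1)) <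
      ∑ α ∈ I, (m α : ℚ) - ρ * (I.card / 2 - h₂.2.natDegree) - ρ * w / 2 := by
    rw [hw]
    linear_combination hlist
  have hwdeg := hQ.wdeg_lt (Δ := ∑ α ∈ I, (m α : ℚ) - ρ * (I.card / 2 - h₂.2.natDegree)) hbasis hmJ
    ((div_lt_iff₀' (by positivity)).1 hlist_Δ)
  obtain ⟨R, ⟨hR, hmult⟩, rfl⟩ := hQ.1
  refine dvd_dehomog_of_aeval_eq_zero hR hcop <|
    eq_zero_of_X_sub_C_pow_dvd inv_sq_injective.injOn (fun α hα => ?_)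
      (degree_aeval_lt hR hf₁deg hf₂deg hwdeg (by push_cast; rw [sub_add_cancel]))
  exact X_sub_C_sq_pow_dvd_aeval hcop (hbasis.eval_mu_ne_zero α⁻¹.ne_zero)
    (hσ ▸ eval_inv_elp hα) hR (by simpa only [inv_inv] using hmult α⁻¹)

theorem mainTheorem7 {K : Type*} [Field K] [Fintype K] [DecidableEq K] [Algebra (ZMod 2) K]
    (s t : ℕ) (ht : 1 ≤ t) (hK : Fintype.card K = 2 ^ s)
    (γ : Kˣ) (hγ : IsPrimitiveRoot γ (2 ^ s - 1))
    (x e y : Fin (2 ^ s - 1) → ZMod 2)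
    (hx : x ∈ BinaryBCH.bchCode (2 ^ s - 1) t γ) (hy : y = x + e)
    (I : Finset Kˣ) (hI : I = BinaryBCH.errorSet γ e)
    (h₁ h₂ : K[X] × K[X])
    (hbasis : BinaryBCH.IsSolBasis t (BinaryBCH.syndromePoly t γ y) h₁ h₂)
    (f₁ f₂ : K[X]) (hf : BinaryBCH.mu.symm (BinaryBCH.elp I) = f₁ • h₁ + f₂ • h₂)
    (J : Finset Kˣ) (m ρ : ℕ) (hm : 1 ≤ m) (hρ : 1 ≤ ρ)
    (w : ℚ) (hw : w = 2 * (h₂.2.natDegree : ℚ) - t - 1 / 2)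
    (hlist : (m : ℚ) * ((I ∩ J).card : ℚ) >
      if Odd ρ then
        (J.card : ℚ) * (m * (m + 1)) / (2 * (ρ + 1)) + ρ / 2 * ((I.card : ℚ) - t - 1 / 2)
      else
        ((J.card : ℚ) * (m * (m + 1)) + 1) / (2 * (ρ + 1)) +
          ρ / 2 * ((I.card : ℚ) - t - 1 / 2))
    (Q : MvPolynomial (Fin 2) K)
    (hQ : BinaryBCH.IsMinimizer w
      (BinaryBCH.interpModuleDehomog h₁ h₂ (fun z => if z ∈ J then m else 0) ρ) Q)
    (hf₂ : f₂ ≠ 0) :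
    MvPolynomial.X 1 * BinaryBCH.inX f₂ + BinaryBCH.inX f₁ ∣ Q := by
  have : CharP K 2 := charP_of_injective_algebraMap (algebraMap (ZMod 2) K).injective 2
  exact mainTheorem7_general hbasis hf (fun α hα => if_neg hα) hw
    (BinaryBCH.sum_ite_mem_div_add_lt hlist) hQ
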